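/- Let $E$ be a separable complex Hilbert space, $E^*$ its (linear) dual, $\mathbb{D}$ the open unit disc and $\mathbb{T}$ the unit circle. For a normed space $X$ let $H^\infty_X$ be the space of bounded analytic functions $\mathbb{D}\to X$, with $H^\infty:=H^\infty_{\mathbb{C}}$ and $H^\infty_{E\to E}:=H^\infty_X$ for $X$ the space of bounded operators on $E$ with the operator norm. For a Hilbert space $X$ let $H^2_X$ be the space of analytic functions $h:\mathbb{D}\to X$ with $\|h\|_2^2:=\sup_{0\le r<1}\frac1{2\pi}\int_0^{2\pi}\|h(re^{i\theta})\|^2\,d\theta<\infty$, and $H^2:=H^2_{\mathbb{C}}$. A function $f\in H^\infty_E$ is called inner if its radial boundary values satisfy $\|f(\xi)\|=1$ for a.e. $\xi\in\mathbb{T}$. It is called co-outer if the function $f^\#(z):=f(\overline z)^*=\langle\,\cdot\,,f(\overline z)\rangle$, $z\in\mathbb{D}$, whose values are operators $E\to\mathbb{C}$, is outer, i.e. if $\{f^\# h: h\in H^2_E\}$ is dense in $H^2$. Lemma. Let $f\in H^\infty_E$ be inner and co-outer, and let $\tau\in H^\infty$. Then there exists $g\in H^\infty_{E^*}$ with $g(z)f(z)=\tau(z)$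 for all $z\in\mathbb{D}$ if and only if there exists an operator-valued function $R\in H^\infty_{E\to E}$ such that $$R(z)^2=\tau(z)R(z)\quad\text{for all } z\in\mathbb{D},\qquad \operatorname{ran}R(z)=\operatorname{span}\{f(z)\}\quad\text{for all } z\in\mathbb{D}\text{ with }\tau(z)\neq0.$$ -/

import Mathlib

open Metric Set Filter Topology MeasureTheory
open scoped ENNReal ComplexConjugate InnerProduct

namespace Hardy

/-- The open unit disc `𝔻`.  Functions on `𝔻` are represented by functions on `ℂ` of which only
the values on `𝔻` matter. -/
abbrev disc : Set ℂ := ball (0 : ℂ) 1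

/-- `H^∞` with values in a normed space `X`: bounded analytic functions on the disc.  For
`X = ℂ, E, E →L[ℂ] ℂ, E →L[ℂ] E'` this is `H^∞`, `H^∞_E`, `H^∞_{E^*}`, `H^∞_{E → E'}`. -/
def MemHInfty {X : Type*} [NormedAddCommGroup X] [NormedSpace ℂ X] (F : ℂ → X) : Prop :=
  DifferentiableOn ℂ F disc ∧ ∃ C : ℝ, ∀ z ∈ disc, ‖F z‖ ≤ C

/-- The squared `H²` norm `sup_{0 ≤ r < 1} (1/2π) ∫₀^{2π} ‖h(r e^{iθ})‖² dθ`, in `[0, ∞]`. -/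
noncomputable def hTwoNormSq {X : Type*} [NormedAddCommGroup X] (h : ℂ → X) : ℝ≥0∞ :=
  ⨆ r ∈ Ico (0 : ℝ) 1, ENNReal.ofReal (Real.circleAverage (fun z => ‖h z‖ ^ 2) 0 r)

/-- The Hardy class `H²_X`: analytic functions on the disc with finite `H²` norm. -/
def MemHTwo {X : Type*} [NormedAddCommGroup X] [NormedSpace ℂ X] (h : ℂ → X) : Prop :=
  DifferentiableOn ℂ h disc ∧ hTwoNormSq h < ∞

section Operator

variable {E E' : Type*} [NormedAddCommGroup E] [InnerProductSpace ℂ E] [CompleteSpace E]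
  [NormedAddCommGroup E'] [InnerProductSpace ℂ E'] [CompleteSpace E']

/-- An operator function `F ∈ H^∞_{E → E'}` is inner if `F^* F = I` almost everywhere on the unit
circle.  The boundary value `V` at `e^{iθ}` is the strong radial limit of `F`. -/
def IsInner (F : ℂ → E →L[ℂ] E') : Prop :=
  ∀ᵐ θ : ℝ, ∃ V : E →L[ℂ] E',
    (∀ x : E, Tendsto (fun r : ℝ => F (circleMap 0 r θ) x) (𝓝[<] 1) (𝓝 (V x))) ∧
      V.adjoint ∘L V = ContinuousLinearMap.id ℂ E

/-- An operator function `F ∈ H^∞_{E → E'}` is outer if `F H²_E` is dense in `H²_{E'}`. -/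
def IsOuter (F : ℂ → E →L[ℂ] E') : Prop :=
  ∀ p : ℂ → E', MemHTwo p → ∀ ε : ℝ≥0∞, 0 < ε →
    ∃ h : ℂ → E, MemHTwo h ∧ hTwoNormSq (fun z => F z (h z) - p z) < ε

/-- An operator function `F ∈ H^∞_{E → E'}` is co-outer if `z ↦ F(z̄)^*` is outer. -/
def IsCoOuter (F : ℂ → E →L[ℂ] E') : Prop :=
  IsOuter fun z => (F (conj z)).adjoint

/-- A function with values in `E`, seen as a function whose values are operators `ℂ → E`. -/
noncomputable def column (f : ℂ → E) : ℂ → ℂ →L[ℂ] E :=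
  fun z => ContinuousLinearMap.toSpanSingleton ℂ (f z)

end Operator

end Hardy

/-! Given `g`, the rank-one function `R = f g` works. Conversely, off the zeros of `τ` every `R(z)x`
is a multiple of `f(z)`. Since `f` is co-outer it has no zeros (`IsCoOuter.ne_zero`), so `R(z)x =
(g(z)x) f(z)` defines an analytic `g` on the whole disc, and `R f = τ f` gives `g f = τ`.

The difficulty is the boundedness of `g`: only `|g x| ‖f‖ ≤ C ‖x‖` is known, and `‖f‖` may be small
inside the disc. Let `v` be analytic with `|v(z)| ‖f(z̄)‖ ≤ 1`. As `‖f‖ = 1` on the circle,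
multiplication by `v` is contractive on `f^#` times polynomials (`circleAverage_mul_inner_le`).
These are dense in `H²` by co-outerness, so it is contractive on all of `H²`
(`circleAverage_mul_le`). Hence every power `v^n` has `H²` norm at most one, and boundedness of
point evaluations forces `|v| ≤ 1` (`norm_le_one_of_norm_mul_le`). -/

namespace Hardy

open Real (circleAverage)

/-! ### Parseval's identity and quadratic means on circles. -/

section Means

variable {X : Type*} [NormedAddCommGroup X] [InnerProductSpace ℂ X]

lemma sphere_subset_disc {r : ℝ} (hr : r ∈ Ico (0 : ℝ) 1) : sphere (0 : ℂ) |r| ⊆ disc := by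
  rw [abs_of_nonneg hr.1]
  exact sphere_subset_ball hr.2

lemma circleIntegrable_norm_sq {X : Type*} [NormedAddCommGroup X] {h : ℂ → X} (hh : ContinuousOn h disc) {r : ℝ}
    (hr : r ∈ Ico (0 : ℝ) 1) : CircleIntegrable (fun z => ‖h z‖ ^ 2) 0 r :=
  ((hh.mono (sphere_subset_disc hr)).norm.pow 2).circleIntegrable'

lemma norm_circleAverage_le {X : Type*} [NormedAddCommGroup X] [NormedSpace ℝ X] (F : ℂ → X)
    (r : ℝ) : ‖circleAverage F 0 r‖ ≤ circleAverage (fun z => ‖F z‖) 0 r := by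
  unfold circleAverage
  rw [norm_smul, smul_eq_mul, Real.norm_of_nonneg (by positivity)]
  gcongr
  exact intervalIntegral.norm_integral_le_integral_norm Real.two_pi_pos.le

lemma circleAverage_norm_sq_sum (a : ℕ → X) (N : ℕ) (r : ℝ) :
    circleAverage (fun z => ‖∑ n ∈ Finset.range N, z ^ n • a n‖ ^ 2) 0 r
      = ∑ n ∈ Finset.range N, (r ^ 2) ^ n * ‖a n‖ ^ 2 := by
  induction N with
  | zero => simp [Real.circleAverage_const]
  | succ N ih =>
    -- On the circle `conj z * z = r ^ 2`, so the cross term with the new summand agrees with a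
    -- polynomial in `z` vanishing at 0; its mean is zero.
    set P : ℂ → ℂ := fun z => ∑ n ∈ Finset.range N, ((r : ℂ) ^ 2) ^ n * z ^ (N - n) *
      inner ℂ (a n) (a N) with hP
    have hPd : Differentiable ℂ P := by fun_prop
    have hP0 : circleAverage P 0 r = 0 := by
      rw [hPd.diffContOnCl.circleAverage, hP]
      refine Finset.sum_eq_zero fun n hn => ?_
      have : N - n ≠ 0 := by have := Finset.mem_range.1 hn; omega
      simp [this]
    have hP1 : circleAverage (fun z => (P z).re) 0 r = 0 := by
      have := Complex.reCLM.circleAverage_comp_comm (f := P) (c := 0) (R := r)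
        hPd.continuous.continuousOn.circleIntegrable'
      rw [hP0] at this
      simpa [Function.comp_def] using this
    have key : circleAverage (fun z => ‖∑ n ∈ Finset.range (N + 1), z ^ n • a n‖ ^ 2) 0 r
        = circleAverage (fun z => ‖∑ n ∈ Finset.range N, z ^ n • a n‖ ^ 2 +
            (2 * (P z).re + (r ^ 2) ^ N * ‖a N‖ ^ 2)) 0 r := by
      refine Real.circleAverage_congr_sphere fun z hz => ?_
      have hz' : ‖z‖ = |r| := by simpa using hz
      have hzz : conj z * z = (r : ℂ) ^ 2 := by
        rw [mul_comm, Complex.mul_conj, Complex.normSq_eq_norm_sq, hz', sq_abs]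
        push_cast; rfl
      have hin : inner ℂ (∑ n ∈ Finset.range N, z ^ n • a n) (z ^ N • a N) = P z := by
        rw [sum_inner, hP]
        refine Finset.sum_congr rfl fun n hn => ?_
        have hn := Finset.mem_range.1 hn
        have hpow : z ^ N = z ^ n * z ^ (N - n) := by rw [← pow_add, Nat.add_sub_cancel' hn.le]
        rw [inner_smul_left, inner_smul_right, ← hzz, map_pow, mul_pow, hpow]
        ring
      rw [Finset.sum_range_succ, norm_add_sq (𝕜 := ℂ), hin, norm_smul, norm_pow, hz', mul_pow,
        ← pow_mul, mul_comm N 2, pow_mul, sq_abs]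
      simp only [RCLike.re_to_complex]
      ring
    rw [key, Finset.sum_range_succ, Real.circleAverage_fun_add, Real.circleAverage_fun_add, ih,
      Real.circleAverage_const]
    · have : circleAverage (fun z => 2 * (P z).re) 0 r = 0 := by
        have := Real.circleAverage_fun_smul (a := (2 : ℝ)) (f := fun z => (P z).re) (c := 0) (R := r)
        simpa [hP1] using this
      rw [this, zero_add]
    all_goals
      refine ContinuousOn.circleIntegrable' (Continuous.continuousOn ?_)
      have := hPd.continuous
      fun_prop

/-- Parseval's identity on circles inside the disc. -/
lemma hasSum_circleAverage_norm_sq {a : ℕ → X} {h : ℂ → X}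
    (hh : ∀ z ∈ disc, HasSum (fun n => z ^ n • a n) (h z)) {r : ℝ} (hr : r ∈ Ico (0 : ℝ) 1) :
    HasSum (fun n => (r ^ 2) ^ n * ‖a n‖ ^ 2) (circleAverage (fun z => ‖h z‖ ^ 2) 0 r) := by
  rw [hasSum_iff_tendsto_nat_of_nonneg (fun n => by positivity)]
  simp_rw [← circleAverage_norm_sq_sum]
  -- The terms are bounded at a larger radius `s < 1`; the square of this sum is the dominating
  -- constant below.
  have hsum : Summable fun n => r ^ n * ‖a n‖ := by
    obtain ⟨s, hrs, hs⟩ := exists_between hr.2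
    have hs0 : 0 < s := hr.1.trans_lt hrs
    have hsd : (s : ℂ) ∈ disc := by simpa [abs_of_pos hs0] using hs
    have h0 := (hh s hsd).summable.tendsto_atTop_zero.norm
    obtain ⟨C, hC⟩ := h0.bddAbove_range
    refine Summable.of_nonneg_of_le (fun n => mul_nonneg (pow_nonneg hr.1 n) (norm_nonneg _))
      (fun n => ?_) ((summable_geometric_of_lt_one (div_nonneg hr.1 hs0.le)
        ((div_lt_one hs0).2 hrs)).mul_right C)
    have h1 : s ^ n * ‖a n‖ ≤ C := by
      have := hC ⟨n, rfl⟩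
      simpa [norm_smul, abs_of_pos hs0] using this
    calc r ^ n * ‖a n‖ = (r / s) ^ n * (s ^ n * ‖a n‖) := by
          rw [div_pow]; field_simp
      _ ≤ _ := by
          have := div_nonneg hr.1 hs0.le
          gcongr
  unfold circleAverage
  refine Tendsto.const_smul ?_ _
  refine intervalIntegral.tendsto_integral_filter_of_dominated_convergence
    (fun _ => (∑' n, r ^ n * ‖a n‖) ^ 2) ?_ ?_ ?_ ?_
  · refine Eventually.of_forall fun N => ?_
    have : Continuous fun θ : ℝ => ‖∑ n ∈ Finset.range N, (circleMap 0 r θ) ^ n • a n‖ ^ 2 := by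
      fun_prop
    exact this.aestronglyMeasurable
  · refine Eventually.of_forall fun N => Eventually.of_forall fun θ _ => ?_
    rw [Real.norm_of_nonneg (by positivity)]
    refine pow_le_pow_left₀ (norm_nonneg _) ?_ 2
    refine (norm_sum_le _ _).trans ?_
    simp only [norm_smul, norm_pow, norm_circleMap_zero, abs_of_nonneg hr.1]
    exact hsum.sum_le_tsum _ fun n _ => mul_nonneg (pow_nonneg hr.1 n) (norm_nonneg _)
  · exact intervalIntegrable_const
  · refine Eventually.of_forall fun θ _ => ?_
    exact ((hh _ (sphere_subset_disc hr (circleMap_mem_sphere' 0 r θ))).tendsto_sum_nat.norm).pow 2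

lemma exists_hasSum_of_differentiableOn [CompleteSpace X] {h : ℂ → X}
    (hh : DifferentiableOn ℂ h disc) :
    ∃ a : ℕ → X, ∀ z ∈ disc, HasSum (fun n => z ^ n • a n) (h z) := by
  refine ⟨fun n => (n.factorial : ℂ)⁻¹ • iteratedDeriv n h 0, fun z hz => ?_⟩
  have := Complex.hasSum_taylorSeries_on_ball hh hz
  simpa only [sub_zero, smul_comm ((_ : ℂ)⁻¹)] using this

lemma circleAverage_norm_sq_mono [CompleteSpace X] {h : ℂ → X} (hh : DifferentiableOn ℂ h disc)
    {r s : ℝ} (hr : 0 ≤ r) (hrs : r ≤ s) (hs : s < 1) :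
    circleAverage (fun z => ‖h z‖ ^ 2) 0 r ≤ circleAverage (fun z => ‖h z‖ ^ 2) 0 s := by
  obtain ⟨a, ha⟩ := exists_hasSum_of_differentiableOn hh
  refine hasSum_le (fun n => ?_) (hasSum_circleAverage_norm_sq ha ⟨hr, hrs.trans_lt hs⟩)
    (hasSum_circleAverage_norm_sq ha ⟨hr.trans hrs, hs⟩)
  gcongr

lemma hTwoNormSq_le_iff {Y : Type*} [NormedAddCommGroup Y] {h : ℂ → Y} {c : ℝ} (hc : 0 ≤ c) :
    hTwoNormSq h ≤ ENNReal.ofReal c ↔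
      ∀ r ∈ Ico (0 : ℝ) 1, circleAverage (fun z => ‖h z‖ ^ 2) 0 r ≤ c := by
  simp only [hTwoNormSq, iSup_le_iff]
  exact forall₂_congr fun r _ => ENNReal.ofReal_le_ofReal_iff hc

lemma memHTwo_of_le {h : ℂ → X} (hh : DifferentiableOn ℂ h disc) {c : ℝ}
    (hc : ∀ r ∈ Ico (0 : ℝ) 1, circleAverage (fun z => ‖h z‖ ^ 2) 0 r ≤ c) : MemHTwo h := by
  refine ⟨hh, lt_of_le_of_lt ((hTwoNormSq_le_iff (le_max_right c 0)).2 fun r hr => ?_)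
    ENNReal.ofReal_lt_top⟩
  exact (hc r hr).trans (le_max_left c 0)

lemma MemHTwo.exists_le {h : ℂ → X} (hh : MemHTwo h) :
    ∃ c, 0 ≤ c ∧ ∀ r ∈ Ico (0 : ℝ) 1, circleAverage (fun z => ‖h z‖ ^ 2) 0 r ≤ c := by
  refine ⟨(hTwoNormSq h).toReal, ENNReal.toReal_nonneg, ?_⟩
  rw [← hTwoNormSq_le_iff ENNReal.toReal_nonneg, ENNReal.ofReal_toReal hh.2.ne]

/-- Taylor polynomials approximate in `H²`. -/
lemma MemHTwo.exists_polynomial [CompleteSpace X] {h : ℂ → X} (hh : MemHTwo h) {ε : ℝ}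
    (hε : 0 < ε) : ∃ (N : ℕ) (a : ℕ → X), ∀ r ∈ Ico (0 : ℝ) 1,
      circleAverage (fun z => ‖h z - ∑ n ∈ Finset.range N, z ^ n • a n‖ ^ 2) 0 r ≤ ε := by
  obtain ⟨a, ha⟩ := exists_hasSum_of_differentiableOn hh.1
  obtain ⟨c, hc0, hc⟩ := hh.exists_le
  have hpart : ∀ N, ∑ n ∈ Finset.range N, ‖a n‖ ^ 2 ≤ c := by
    intro N
    have hcont : Tendsto (fun r : ℝ => ∑ n ∈ Finset.range N, (r ^ 2) ^ n * ‖a n‖ ^ 2) (𝓝[<] 1)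
        (𝓝 (∑ n ∈ Finset.range N, ‖a n‖ ^ 2)) := by
      have : Continuous (fun r : ℝ => ∑ n ∈ Finset.range N, (r ^ 2) ^ n * ‖a n‖ ^ 2) := by fun_prop
      simpa using (this.tendsto 1).mono_left nhdsWithin_le_nhds
    refine le_of_tendsto hcont ?_
    filter_upwards [Ico_mem_nhdsLT (zero_lt_one' ℝ)] with r hr
    exact (sum_le_hasSum _ (fun n _ => by positivity) (hasSum_circleAverage_norm_sq ha hr)).trans
      (hc r hr)
  have hsum : Summable fun n => ‖a n‖ ^ 2 :=
    summable_of_sum_range_le (fun n => by positivity) hpart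
  obtain ⟨N, hN⟩ := ((tendsto_sum_nat_add fun n => ‖a n‖ ^ 2).eventually
    (eventually_le_nhds hε)).exists
  refine ⟨N, a, fun r hr => ?_⟩
  -- Parseval for the remainder, whose first `N` coefficients vanish, leaves a tail of `∑ ‖a n‖ ^
  -- 2`.
  have hb : ∀ z ∈ disc, HasSum (fun n => z ^ n • (if n < N then 0 else a n))
      (h z - ∑ n ∈ Finset.range N, z ^ n • a n) := by
    intro z hz
    have h1 := (ha z hz).sub (hasSum_sum_of_ne_finset_zero (s := Finset.range N)
      (f := fun n => if n < N then z ^ n • a n else 0) fun n hn => if_neg (by simpa using hn))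
    rw [Finset.sum_congr rfl fun n hn => if_pos (Finset.mem_range.1 hn)] at h1
    refine h1.congr_fun ?_
    intro n
    split_ifs <;> simp
  have hs := hasSum_circleAverage_norm_sq hb hr
  refine le_trans ?_ hN
  rw [← hs.tsum_eq, ← hs.summable.sum_add_tsum_nat_add N, Finset.sum_eq_zero, zero_add]
  · refine Summable.tsum_le_tsum (fun n => ?_) ((summable_nat_add_iff N).2 hs.summable)
      ((summable_nat_add_iff N).2 hsum)
    simp only [Nat.not_lt.2 (Nat.le_add_left N n), if_false]
    refine mul_le_of_le_one_left (by positivity) (pow_le_one₀ (by positivity) ?_)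
    exact pow_le_one₀ hr.1 hr.2.le
  · intro n hn
    simp [Finset.mem_range.1 hn]

lemma circleAverage_const_mul (c : ℝ) (F : ℂ → ℝ) (r : ℝ) :
    circleAverage (fun z => c * F z) 0 r = c * circleAverage F 0 r :=
  Real.circleAverage_fun_smul (a := c) (f := F)

/-- Point evaluations are bounded with respect to quadratic means. -/
lemma exists_norm_sq_le_circleAverage {z : ℂ} (hz : z ∈ disc) :
    ∃ K : ℝ, 0 ≤ K ∧ ∃ r ∈ Ico (0 : ℝ) 1, ∀ k : ℂ → ℂ, DifferentiableOn ℂ k disc →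
      ‖k z‖ ^ 2 ≤ K * circleAverage (fun w => ‖k w‖ ^ 2) 0 r := by
  have hz1 : ‖z‖ < 1 := by simpa using hz
  obtain ⟨r, hzr, hr1⟩ := exists_between hz1
  have hr0 : 0 < r := (norm_nonneg z).trans_lt hzr
  have hr : r ∈ Ico (0 : ℝ) 1 := ⟨hr0.le, hr1⟩
  have hK : 0 ≤ r / (r - ‖z‖) := div_nonneg hr0.le (sub_pos.2 hzr).le
  refine ⟨r / (r - ‖z‖), hK, r, hr, fun k hk => ?_⟩
  have hsub : closedBall (0 : ℂ) r ⊆ disc := closedBall_subset_ball hr1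
  -- Cauchy's formula is applied to `k ^ 2`, which produces the quadratic mean directly; `r / (r -
  -- ‖z‖)` bounds the kernel.
  have hdc : DiffContOnCl ℂ (fun w => k w ^ 2) (ball 0 |r|) := by
    rw [abs_of_pos hr0]
    exact ((hk.pow 2).mono hsub).diffContOnCl_ball subset_rfl
  have hne : ∀ w ∈ sphere (0 : ℂ) |r|, w - z ≠ 0 := by
    intro w hw h0
    have : ‖w‖ = r := by simpa [abs_of_pos hr0] using hw
    rw [sub_eq_zero] at h0
    subst h0
    exact hzr.ne this
  have hkc : ContinuousOn k (sphere 0 |r|) := hk.continuousOn.mono (sphere_subset_disc hr)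
  rw [← norm_pow, ← hdc.circleAverage_smul_div (w := z) (by simpa [abs_of_pos hr0] using hzr),
    ← circleAverage_const_mul]
  refine (norm_circleAverage_le _ r).trans (Real.circleAverage_mono ?_ ?_ ?_)
  · have hq : ContinuousOn (fun w : ℂ => (w - 0) / (w - z)) (sphere 0 |r|) :=
      ContinuousOn.div (by fun_prop) (by fun_prop) hne
    exact (hq.smul (hkc.pow 2)).norm.circleIntegrable'
  · exact ContinuousOn.circleIntegrable' (continuousOn_const.mul (hkc.norm.pow 2))
  · intro w hw
    have hw' : ‖w‖ = r := by simpa [abs_of_pos hr0] using hw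
    rw [norm_smul, norm_pow, norm_div, sub_zero, hw']
    have : r - ‖z‖ ≤ ‖w - z‖ := hw' ▸ norm_sub_norm_le w z
    have := sub_pos.2 hzr
    gcongr

end Means
-- Contractivity on `f^#` times polynomials.
lemma conj_mem_disc {z : ℂ} (hz : z ∈ disc) : conj z ∈ disc := by simpa using hz

/-- A weighted substitute for Minkowski's inequality: letting `δ → 0` keeps the leading constant
equal to 1, which iteration over powers requires. -/
lemma circleAverage_norm_sq_le_add {u w : ℂ → ℂ} (hu : ContinuousOn u disc)
    (hw : ContinuousOn w disc) {r δ : ℝ} (hr : r ∈ Ico (0 : ℝ) 1) (hδ : 0 < δ) :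
    circleAverage (fun z => ‖u z‖ ^ 2) 0 r ≤ (1 + δ) * circleAverage (fun z => ‖w z‖ ^ 2) 0 r +
      (1 + δ⁻¹) * circleAverage (fun z => ‖u z - w z‖ ^ 2) 0 r := by
  have hi1 := (circleIntegrable_norm_sq hw hr).const_fun_smul (a := 1 + δ)
  have hi2 := (circleIntegrable_norm_sq (hu.sub hw) hr).const_fun_smul (a := 1 + δ⁻¹)
  simp only [smul_eq_mul, Pi.sub_apply] at hi1 hi2
  rw [← circleAverage_const_mul, ← circleAverage_const_mul, ← Real.circleAverage_fun_add hi1 hi2]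
  refine Real.circleAverage_mono (circleIntegrable_norm_sq hu hr) (hi1.add hi2) fun z _ => ?_
  have h1 : ‖u z‖ ≤ ‖w z‖ + ‖u z - w z‖ := by
    simpa using norm_add_le (w z) (u z - w z)
  have h2 : 0 ≤ δ⁻¹ * (δ * ‖w z‖ - ‖u z - w z‖) ^ 2 := by positivity
  have h3 : δ⁻¹ * (δ * ‖w z‖ - ‖u z - w z‖) ^ 2 =
      δ * ‖w z‖ ^ 2 - 2 * ‖w z‖ * ‖u z - w z‖ + δ⁻¹ * ‖u z - w z‖ ^ 2 := by
    field_simp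
    ring
  have h4 := pow_le_pow_left₀ (norm_nonneg _) h1 2
  nlinarith

variable {E : Type*} [NormedAddCommGroup E] [InnerProductSpace ℂ E]

/-- The conjugate-linear first slot cancels the conjugation of the variable. -/
lemma differentiableOn_inner_conj {f : ℂ → E} (hf : DifferentiableOn ℂ f disc) (x : E) :
    DifferentiableOn ℂ (fun z => inner ℂ (f (conj z)) x) disc := by
  intro z hz
  have h1 : DifferentiableAt ℂ (fun w => inner ℂ x (f w)) (conj z) :=
    ((innerSL ℂ x).differentiableAt).comp _
      (hf.differentiableAt (isOpen_ball.mem_nhds (conj_mem_disc hz)))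
  have h2 := h1.conj_conj
  simp only [Complex.conj_conj] at h2
  refine (h2.congr_of_eventuallyEq (Eventually.of_forall fun w => ?_)).differentiableWithinAt
  simp [Function.comp_def]

lemma differentiableOn_inner_conj_sum {f : ℂ → E} (hf : DifferentiableOn ℂ f disc) (N : ℕ)
    (a : ℕ → E) : DifferentiableOn ℂ
      (fun z => inner ℂ (f (conj z)) (∑ n ∈ Finset.range N, z ^ n • a n)) disc := by
  simp only [inner_sum, inner_smul_right]
  exact DifferentiableOn.fun_sum fun n _ =>
    (differentiableOn_id.pow n).mul (differentiableOn_inner_conj hf (a n))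

lemma continuousOn_comp_conj {E : Type*} [NormedAddCommGroup E] {f : ℂ → E} (hf : ContinuousOn f disc) :
    ContinuousOn (fun z => f (conj z)) disc :=
  hf.comp Complex.continuous_conj.continuousOn fun _ hz => conj_mem_disc hz

/-- Dominated convergence; conjugation replaces `θ` by `-θ`, which preserves null sets. -/
lemma tendsto_circleAverage_one_sub_norm_sq {f : ℂ → E} (hf : MemHInfty f)
    (hlim : ∀ᵐ θ : ℝ, Tendsto (fun r : ℝ => ‖f (circleMap 0 r θ)‖) (𝓝[<] 1) (𝓝 1)) :
    Tendsto (fun r => circleAverage (fun z => |1 - ‖f (conj z)‖ ^ 2|) 0 r) (𝓝[<] 1) (𝓝 0) := by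
  obtain ⟨hfd, B, hB⟩ := hf
  have hconj : ∀ r θ : ℝ, conj (circleMap 0 r θ) = circleMap 0 r (-θ) := by
    intro r θ
    simp [circleMap, ← Complex.exp_conj]
  have hmem : ∀ r ∈ Ico (0 : ℝ) 1, ∀ θ, circleMap 0 r θ ∈ disc := fun r hr θ =>
    sphere_subset_disc hr (circleMap_mem_sphere' 0 r θ)
  have hlim' : ∀ᵐ θ : ℝ, Tendsto (fun r : ℝ => ‖f (circleMap 0 r (-θ))‖) (𝓝[<] 1) (𝓝 1) :=
    (Measure.measurePreserving_neg (volume : Measure ℝ)).quasiMeasurePreserving.ae hlim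
  have hgoal : Tendsto (fun r : ℝ => ∫ θ in (0 : ℝ)..2 * Real.pi,
      |1 - ‖f (conj (circleMap 0 r θ))‖ ^ 2|) (𝓝[<] 1) (𝓝 (∫ _ in (0 : ℝ)..2 * Real.pi, 0)) := by
    refine intervalIntegral.tendsto_integral_filter_of_dominated_convergence
      (fun _ => 1 + B ^ 2) ?_ ?_ intervalIntegrable_const ?_
    · filter_upwards [Ico_mem_nhdsLT (zero_lt_one' ℝ)] with r hr
      have hc : Continuous fun θ : ℝ => f (conj (circleMap 0 r θ)) :=
        (continuousOn_comp_conj hfd.continuousOn).comp_continuous (continuous_circleMap 0 r)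
          (hmem r hr)
      exact (continuous_const.sub (hc.norm.pow 2)).abs.aestronglyMeasurable
    · filter_upwards [Ico_mem_nhdsLT (zero_lt_one' ℝ)] with r hr
      refine Eventually.of_forall fun θ _ => ?_
      have h1 := pow_le_pow_left₀ (norm_nonneg _) (hB _ (conj_mem_disc (hmem r hr θ))) 2
      have h2 : 0 ≤ ‖f (conj (circleMap 0 r θ))‖ ^ 2 := by positivity
      rw [Real.norm_eq_abs, abs_abs, abs_le]
      constructor <;> linarith
    · filter_upwards [hlim'] with θ hθ _
      have := ((hθ.pow 2).const_sub 1).abs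
      simpa [hconj] using this
  have := hgoal.const_smul (2 * Real.pi)⁻¹
  simpa [circleAverage] using this

lemma norm_sum_pow_smul_le (N : ℕ) (a : ℕ → E) {z : ℂ} (hz : z ∈ disc) :
    ‖∑ n ∈ Finset.range N, z ^ n • a n‖ ≤ ∑ n ∈ Finset.range N, ‖a n‖ := by
  refine (norm_sum_le _ _).trans (Finset.sum_le_sum fun n _ => ?_)
  have hz1 : ‖z‖ ≤ 1 := (by simpa using hz : ‖z‖ < 1).le
  rw [norm_smul, norm_pow]
  exact mul_le_of_le_one_left (norm_nonneg _) (pow_le_one₀ (norm_nonneg _) hz1)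

/-- A quotient by an inner function multiplies the range of the polynomials under `f^#`
contractively. -/
lemma circleAverage_mul_inner_le {f : ℂ → E} (hf : MemHInfty f)
    (hlim : ∀ᵐ θ : ℝ, Tendsto (fun r : ℝ => ‖f (circleMap 0 r θ)‖) (𝓝[<] 1) (𝓝 1))
    {v : ℂ → ℂ} (hv : DifferentiableOn ℂ v disc) (hvf : ∀ z ∈ disc, ‖v z‖ * ‖f (conj z)‖ ≤ 1)
    (N : ℕ) (a : ℕ → E) {c : ℝ}
    (hc : ∀ r ∈ Ico (0 : ℝ) 1, circleAverage
      (fun z => ‖inner ℂ (f (conj z)) (∑ n ∈ Finset.range N, z ^ n • a n)‖ ^ 2) 0 r ≤ c)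
    {r : ℝ} (hr : r ∈ Ico (0 : ℝ) 1) :
    circleAverage
      (fun z => ‖v z * inner ℂ (f (conj z)) (∑ n ∈ Finset.range N, z ^ n • a n)‖ ^ 2) 0 r ≤ c := by
  set l : ℂ → ℂ := fun z => inner ℂ (f (conj z)) (∑ n ∈ Finset.range N, z ^ n • a n) with hl
  set H := ∑ n ∈ Finset.range N, ‖a n‖
  have hld : DifferentiableOn ℂ l disc := differentiableOn_inner_conj_sum hf.1 N a
  have hvl : DifferentiableOn ℂ (fun z => v z * l z) disc := hv.mul hld
  -- Split `1 = ‖f‖ ^ 2 + (1 - ‖f‖ ^ 2)`. The first part is at most `‖l‖ ^ 2`. In the second, `‖v l‖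
  -- ≤ H` because polynomials are bounded, so this error vanishes as `s → 1`.
  have hbound : ∀ s ∈ Ico (0 : ℝ) 1, circleAverage (fun z => ‖v z * l z‖ ^ 2) 0 s ≤
      c + H ^ 2 * circleAverage (fun z => |1 - ‖f (conj z)‖ ^ 2|) 0 s := by
    intro s hs
    have hi1 := circleIntegrable_norm_sq hld.continuousOn hs
    have hfc : ContinuousOn (fun z => f (conj z)) (sphere 0 |s|) :=
      (continuousOn_comp_conj hf.1.continuousOn).mono (sphere_subset_disc hs)
    have hi2 : CircleIntegrable (fun z => H ^ 2 * |1 - ‖f (conj z)‖ ^ 2|) 0 s :=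
      (continuousOn_const.mul (continuousOn_const.sub (hfc.norm.pow 2)).abs).circleIntegrable'
    refine le_trans ?_ (add_le_add_left (hc s hs) _)
    rw [← circleAverage_const_mul, ← Real.circleAverage_fun_add hi1 hi2]
    refine Real.circleAverage_mono (circleIntegrable_norm_sq hvl.continuousOn hs) (hi1.add hi2)
      fun z hz => ?_
    have hzd := sphere_subset_disc hs hz
    have h1 : ‖v z * l z‖ ^ 2 * ‖f (conj z)‖ ^ 2 ≤ ‖l z‖ ^ 2 := by
      rw [← mul_pow, norm_mul]
      refine pow_le_pow_left₀ (by positivity) ?_ 2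
      calc ‖v z‖ * ‖l z‖ * ‖f (conj z)‖ = ‖v z‖ * ‖f (conj z)‖ * ‖l z‖ := by ring
        _ ≤ 1 * ‖l z‖ := by gcongr; exact hvf z hzd
        _ = _ := one_mul _
    have h2 : ‖v z * l z‖ ^ 2 ≤ H ^ 2 := by
      refine pow_le_pow_left₀ (norm_nonneg _) ?_ 2
      calc ‖v z * l z‖ ≤ ‖v z‖ * (‖f (conj z)‖ * H) := by
            rw [norm_mul]
            gcongr
            exact (norm_inner_le_norm _ _).trans
              (mul_le_mul_of_nonneg_left (norm_sum_pow_smul_le N a hzd) (norm_nonneg _))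
        _ = ‖v z‖ * ‖f (conj z)‖ * H := by ring
        _ ≤ 1 * H := by
            gcongr
            exact hvf z hzd
        _ = H := one_mul _
    have h3 : ‖v z * l z‖ ^ 2 * (1 - ‖f (conj z)‖ ^ 2) ≤ H ^ 2 * |1 - ‖f (conj z)‖ ^ 2| :=
      (mul_le_mul_of_nonneg_left (le_abs_self _) (by positivity)).trans
        (mul_le_mul_of_nonneg_right h2 (abs_nonneg _))
    linarith
  have hlimit := ((tendsto_circleAverage_one_sub_norm_sq hf hlim).const_mul (H ^ 2)).const_add c
  rw [mul_zero, add_zero] at hlimit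
  refine ge_of_tendsto hlimit ?_
  filter_upwards [Ico_mem_nhdsLT hr.2] with s hs
  exact (circleAverage_norm_sq_mono hvl hr.1 hs.1 hs.2).trans
    (hbound s ⟨hr.1.trans hs.1, hs.2⟩)

/-! ### Consequences of co-outerness. -/

variable [CompleteSpace E]

lemma adjoint_column_apply (f : ℂ → E) (z : ℂ) (y : E) :
    (column f z).adjoint y = inner ℂ (f z) y := by
  have := ContinuousLinearMap.adjoint_inner_right (column f z) 1 y
  simpa [column] using this

lemma IsCoOuter.exists_polynomial {f : ℂ → E} (hf : MemHInfty f) (hco : IsCoOuter (column f))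
    {p : ℂ → ℂ} (hp : MemHTwo p) {ε : ℝ} (hε : 0 < ε) :
    ∃ (N : ℕ) (a : ℕ → E), ∀ r ∈ Ico (0 : ℝ) 1, circleAverage
      (fun z => ‖p z - inner ℂ (f (conj z)) (∑ n ∈ Finset.range N, z ^ n • a n)‖ ^ 2) 0 r ≤ ε := by
  obtain ⟨hfd, B, hB⟩ := hf
  have hε4 : 0 < ε / 4 := by positivity
  obtain ⟨h, hh, hlt⟩ := hco p hp (ENNReal.ofReal (ε / 4)) (by simpa using hε4)
  simp only [adjoint_column_apply] at hlt
  have h1 := (hTwoNormSq_le_iff hε4.le).1 hlt.le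
  -- `f^#` is bounded by `B`, so this makes the error of truncating `h` at most `ε / 4`. The
  -- splitting with `δ = 1` doubles both errors, for a total of `ε`.
  have hη : 0 < ε / (4 * (B ^ 2 + 1)) := by positivity
  obtain ⟨N, a, hNa⟩ := hh.exists_polynomial hη
  refine ⟨N, a, fun r hr => ?_⟩
  have hfc := continuousOn_comp_conj hfd.continuousOn
  have hq : ContinuousOn (fun z : ℂ => ∑ n ∈ Finset.range N, z ^ n • a n) disc :=
    Continuous.continuousOn (by fun_prop)
  have hcl : ContinuousOn (fun z => inner ℂ (f (conj z)) (∑ n ∈ Finset.range N, z ^ n • a n)) disc :=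
    hfc.inner hq
  have hch : ContinuousOn (fun z => inner ℂ (f (conj z)) (h z)) disc :=
    hfc.inner hh.1.continuousOn
  have hpc := hp.1.continuousOn
  have hsplit := circleAverage_norm_sq_le_add (hpc.sub hcl) (hpc.sub hch) hr one_pos
  have hA : circleAverage (fun z => ‖p z - inner ℂ (f (conj z)) (h z)‖ ^ 2) 0 r ≤ ε / 4 := by
    simpa only [norm_sub_rev] using h1 r hr
  have hD : circleAverage (fun z => ‖(p z - inner ℂ (f (conj z))
      (∑ n ∈ Finset.range N, z ^ n • a n)) - (p z - inner ℂ (f (conj z)) (h z))‖ ^ 2) 0 r ≤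
      ε / 4 := by
    have hi := (circleIntegrable_norm_sq (hh.1.continuousOn.sub hq) hr).const_fun_smul
      (a := B ^ 2)
    simp only [smul_eq_mul] at hi
    calc _ ≤ circleAverage
          (fun z => B ^ 2 * ‖h z - ∑ n ∈ Finset.range N, z ^ n • a n‖ ^ 2) 0 r := by
          refine Real.circleAverage_mono
            (circleIntegrable_norm_sq ((hpc.sub hcl).sub (hpc.sub hch)) hr) hi fun z hz => ?_
          rw [sub_sub_sub_cancel_left, ← inner_sub_right, ← mul_pow]
          refine pow_le_pow_left₀ (norm_nonneg _) ((norm_inner_le_norm _ _).trans ?_) 2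
          gcongr
          exact hB _ (conj_mem_disc (sphere_subset_disc hr hz))
      _ ≤ B ^ 2 * (ε / (4 * (B ^ 2 + 1))) := by
          rw [circleAverage_const_mul]
          gcongr
          exact hNa r hr
      _ ≤ (B ^ 2 + 1) * (ε / (4 * (B ^ 2 + 1))) := by gcongr; linarith
      _ = ε / 4 := by field_simp
  have htwo : (1 : ℝ) + 1⁻¹ = 2 := by norm_num
  rw [htwo, one_add_one_eq_two] at hsplit
  simp only [Pi.sub_apply] at hsplit
  linarith

lemma memHTwo_one : MemHTwo (fun _ : ℂ => (1 : ℂ)) :=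
  memHTwo_of_le (differentiableOn_const 1) (c := 1) fun r _ => by
    simp [Real.circleAverage_const]

/-- At a zero of `f` every `f^# h` would vanish at `conj z`, and so could not approximate the
constant 1, point evaluation being bounded. -/
lemma IsCoOuter.ne_zero {f : ℂ → E} (hf : MemHInfty f) (hco : IsCoOuter (column f)) {z : ℂ}
    (hz : z ∈ disc) : f z ≠ 0 := by
  intro h0
  obtain ⟨K, hK, r, hr, hev⟩ := exists_norm_sq_le_circleAverage (conj_mem_disc hz)
  obtain ⟨N, a, hNa⟩ := hco.exists_polynomial hf memHTwo_one (ε := 1 / (2 * (K + 1)))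
    (by positivity)
  have h1 := hev _ ((differentiableOn_const 1).sub (differentiableOn_inner_conj_sum hf.1 N a))
  have h2 := h1.trans (mul_le_mul_of_nonneg_left (hNa r hr) hK)
  simp only [Pi.sub_apply, Complex.conj_conj, h0, inner_zero_left, sub_zero, norm_one, one_pow]
    at h2
  rw [mul_one_div, le_div_iff₀ (by positivity)] at h2
  linarith

lemma circleAverage_mul_le {f : ℂ → E} (hf : MemHInfty f) (hco : IsCoOuter (column f))
    (hlim : ∀ᵐ θ : ℝ, Tendsto (fun r : ℝ => ‖f (circleMap 0 r θ)‖) (𝓝[<] 1) (𝓝 1))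
    {v : ℂ → ℂ} (hv : DifferentiableOn ℂ v disc) (hvf : ∀ z ∈ disc, ‖v z‖ * ‖f (conj z)‖ ≤ 1)
    {p : ℂ → ℂ} (hp : DifferentiableOn ℂ p disc) {c : ℝ}
    (hc : ∀ r ∈ Ico (0 : ℝ) 1, circleAverage (fun z => ‖p z‖ ^ 2) 0 r ≤ c)
    {r : ℝ} (hr : r ∈ Ico (0 : ℝ) 1) :
    circleAverage (fun z => ‖v z * p z‖ ^ 2) 0 r ≤ c := by
  have hpc := hp.continuousOn
  have hvc := hv.continuousOn
  obtain ⟨m, hm⟩ := ((isCompact_sphere (0 : ℂ) |r|).exists_bound_of_continuousOn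
    (hvc.mono (sphere_subset_disc hr)))
  -- Here `η` is the error of approximating `p` by `l`; on the fixed circle `v` is bounded by `m`,
  -- so `v l` stays close to `v p`. Then `η → 0` for fixed `δ`, and afterwards `δ → 0`.
  have key : ∀ δ > 0, ∀ η > 0, circleAverage (fun z => ‖v z * p z‖ ^ 2) 0 r ≤
      (1 + δ) * ((1 + δ) * c + (1 + δ⁻¹) * η) + (1 + δ⁻¹) * (m ^ 2 * η) := by
    intro δ hδ η hη
    obtain ⟨N, a, hNa⟩ := hco.exists_polynomial hf (memHTwo_of_le hp hc) hη
    have hld := differentiableOn_inner_conj_sum hf.1 N a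
    set l : ℂ → ℂ := fun z => inner ℂ (f (conj z)) (∑ n ∈ Finset.range N, z ^ n • a n) with hl
    have hlc := hld.continuousOn
    have h1 : ∀ s ∈ Ico (0 : ℝ) 1, circleAverage (fun z => ‖l z‖ ^ 2) 0 s ≤
        (1 + δ) * c + (1 + δ⁻¹) * η := by
      intro s hs
      refine (circleAverage_norm_sq_le_add hlc hpc hs hδ).trans ?_
      simp only [norm_sub_rev (l _)]
      have := hNa s hs
      have := hc s hs
      gcongr
    have h2 := circleAverage_mul_inner_le hf hlim hv hvf N a h1 hr
    refine (circleAverage_norm_sq_le_add (hvc.mul hpc) (hvc.mul hlc) hr hδ).trans ?_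
    have h3 : circleAverage (fun z => ‖v z * p z - v z * l z‖ ^ 2) 0 r ≤ m ^ 2 * η := by
      have hi := (circleIntegrable_norm_sq (hpc.sub hlc) hr).const_fun_smul (a := m ^ 2)
      simp only [smul_eq_mul] at hi
      calc _ ≤ circleAverage (fun z => m ^ 2 * ‖p z - l z‖ ^ 2) 0 r := by
            refine Real.circleAverage_mono
              (circleIntegrable_norm_sq ((hvc.mul hpc).sub (hvc.mul hlc)) hr) hi fun z hz => ?_
            rw [← mul_sub, norm_mul, mul_pow]
            gcongr
            exact hm z hz
        _ ≤ _ := by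
            rw [circleAverage_const_mul]
            gcongr
            exact hNa r hr
    gcongr
    · exact h2
    · exact h3
  have key2 : ∀ δ > 0, circleAverage (fun z => ‖v z * p z‖ ^ 2) 0 r ≤ (1 + δ) * ((1 + δ) * c) := by
    intro δ hδ
    have hcont : Continuous fun η : ℝ =>
      (1 + δ) * ((1 + δ) * c + (1 + δ⁻¹) * η) + (1 + δ⁻¹) * (m ^ 2 * η) := by fun_prop
    have ht := (hcont.tendsto 0).mono_left (nhdsWithin_le_nhds (s := Ioi 0))
    simp only [mul_zero, add_zero] at ht
    exact ge_of_tendsto ht (eventually_nhdsWithin_of_forall fun η hη => key δ hδ η hη)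
  have hcont : Continuous fun δ : ℝ => (1 + δ) * ((1 + δ) * c) := by fun_prop
  have ht := (hcont.tendsto 0).mono_left (nhdsWithin_le_nhds (s := Ioi 0))
  simp only [add_zero, one_mul] at ht
  exact ge_of_tendsto ht (eventually_nhdsWithin_of_forall fun δ hδ => key2 δ hδ)

/-- If `f` is inner and co-outer and `v f^#` is bounded by `1`, then so is `v`. -/
lemma norm_le_one_of_norm_mul_le {f : ℂ → E} (hf : MemHInfty f) (hco : IsCoOuter (column f))
    (hlim : ∀ᵐ θ : ℝ, Tendsto (fun r : ℝ => ‖f (circleMap 0 r θ)‖) (𝓝[<] 1) (𝓝 1))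
    {v : ℂ → ℂ} (hv : DifferentiableOn ℂ v disc) (hvf : ∀ z ∈ disc, ‖v z‖ * ‖f (conj z)‖ ≤ 1)
    {z : ℂ} (hz : z ∈ disc) : ‖v z‖ ≤ 1 := by
  have hpow : ∀ n : ℕ, ∀ r ∈ Ico (0 : ℝ) 1, circleAverage (fun z => ‖v z ^ n‖ ^ 2) 0 r ≤ 1 := by
    intro n
    induction n with
    | zero => intro r _; simp [Real.circleAverage_const]
    | succ n ih =>
      intro r hr
      have := circleAverage_mul_le hf hco hlim hv hvf (hv.pow n) ih hr
      simp only [Pi.pow_apply, ← pow_succ'] at this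
      exact this
  obtain ⟨K, hK, r, hr, hev⟩ := exists_norm_sq_le_circleAverage hz
  by_contra! h1
  -- The evaluation constant `K` does not depend on `n`, so `‖v z‖ ^ (2n) ≤ K` for all `n`, which is
  -- impossible if `‖v z‖ > 1`.
  obtain ⟨n, hn⟩ := pow_unbounded_of_one_lt K (one_lt_pow₀ h1 two_ne_zero)
  have h2 := (hev _ (hv.pow n)).trans (mul_le_mul_of_nonneg_left (hpow n r hr) hK)
  have h3 : ‖v z ^ n‖ ^ 2 = (‖v z‖ ^ 2) ^ n := by rw [norm_pow]; ring
  simp only [Pi.pow_apply, h3] at h2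
  linarith

lemma IsInner.tendsto_norm {f : ℂ → E} (hin : IsInner (column f)) :
    ∀ᵐ θ : ℝ, Tendsto (fun r : ℝ => ‖f (circleMap 0 r θ)‖) (𝓝[<] 1) (𝓝 1) := by
  filter_upwards [hin] with θ ⟨V, hV, hVV⟩
  have h1 : ‖V 1‖ ^ 2 = 1 := by
    have h2 := V.apply_norm_sq_eq_inner_adjoint_left 1
    rw [hVV] at h2
    simpa using h2
  have h3 : ‖V 1‖ = 1 := by
    rwa [pow_eq_one_iff_of_nonneg (norm_nonneg _) two_ne_zero] at h1
  simpa [column, h3] using (hV 1).norm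

/-- If `f` is inner and co-outer and `u f` is bounded by `C`, then so is `u`. -/
lemma norm_le_of_norm_mul_le {f : ℂ → E} (hf : MemHInfty f) (hin : IsInner (column f))
    (hco : IsCoOuter (column f)) {u : ℂ → ℂ} (hu : DifferentiableOn ℂ u disc) {C : ℝ}
    (huf : ∀ z ∈ disc, ‖u z‖ * ‖f z‖ ≤ C) {z : ℂ} (hz : z ∈ disc) : ‖u z‖ ≤ C := by
  have hC : 0 ≤ C := (by positivity : 0 ≤ ‖u z‖ * ‖f z‖).trans (huf z hz)
  -- Normalising by `D > C` allows division even when `C = 0`.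
  refine le_of_forall_gt_imp_ge_of_dense fun D hD => ?_
  have hD0 : 0 < D := hC.trans_lt hD
  have hv : DifferentiableOn ℂ (fun w => conj (u (conj w)) / D) disc := by
    have := differentiableOn_inner_conj hu 1
    simp only [RCLike.inner_apply, one_mul] at this
    exact this.div_const _
  have h1 := norm_le_one_of_norm_mul_le hf hco hin.tendsto_norm hv (fun w hw => ?_)
    (conj_mem_disc hz)
  · simpa [abs_of_pos hD0, div_le_one hD0] using h1
  · have := huf _ (conj_mem_disc hw)
    simp only [norm_div, RCLike.norm_conj, Complex.norm_real, Real.norm_of_nonneg hD0.le]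
    rw [div_mul_eq_mul_div, div_le_one hD0]
    exact this.trans hD.le

end Hardy

/-! ### Passing between `g` and `R`. -/

namespace Hardy

variable {E : Type*} [NormedAddCommGroup E] [InnerProductSpace ℂ E]

lemma exists_memHInfty_smulRight {f : ℂ → E} (hf : MemHInfty f) {τ : ℂ → ℂ}
    {g : ℂ → E →L[ℂ] ℂ} (hg : MemHInfty g) (hgf : ∀ z ∈ disc, g z (f z) = τ z) :
    ∃ R : ℂ → E →L[ℂ] E, MemHInfty R ∧ (∀ z ∈ disc, R z ∘L R z = τ z • R z) ∧
      ∀ z ∈ disc, τ z ≠ 0 → (R z).range = Submodule.span ℂ {f z} := by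
  obtain ⟨hfd, B, hB⟩ := hf
  obtain ⟨hgd, C, hC⟩ := hg
  refine ⟨fun z => (g z).smulRight (f z), ⟨?_, C * B, fun z hz => ?_⟩, fun z hz => ?_,
    fun z hz hτz => ?_⟩
  · exact ((ContinuousLinearMap.smulRightL ℂ E E).isBoundedBilinearMap.differentiableOn).comp
      (hgd.prodMk hfd) (mapsTo_univ _ _)
  · rw [ContinuousLinearMap.norm_smulRight_apply]
    exact mul_le_mul (hC z hz) (hB z hz) (norm_nonneg _) ((norm_nonneg _).trans (hC z hz))
  · ext x
    simp [hgf z hz, smul_smul, mul_comm]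
  · refine le_antisymm ?_ ?_
    · rintro _ ⟨x, rfl⟩
      exact Submodule.smul_mem _ _ (Submodule.mem_span_singleton_self _)
    · rw [Submodule.span_singleton_le_iff_mem]
      refine ⟨(τ z)⁻¹ • f z, ?_⟩
      simp [hgf z hz, hτz]

/-- The zeros of a nontrivial `τ` are isolated, so continuity carries the identity across them. -/
lemma eqOn_disc_of_eq_of_ne_zero {X : Type*} [NormedAddCommGroup X] [NormedSpace ℂ X] {τ : ℂ → ℂ}
    (hτ : DifferentiableOn ℂ τ disc) {w : ℂ} (hw : w ∈ disc) (hτw : τ w ≠ 0) {F G : ℂ → X}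
    (hF : ContinuousOn F disc) (hG : ContinuousOn G disc)
    (h : ∀ z ∈ disc, τ z ≠ 0 → F z = G z) : EqOn F G disc := by
  intro z hz
  have han : AnalyticOnNhd ℂ τ disc := hτ.analyticOnNhd isOpen_ball
  have hne : ∀ᶠ y in 𝓝[≠] z, τ y ≠ 0 := by
    refine (han z hz).eventually_eq_zero_or_eventually_ne_zero.resolve_left fun h0 => hτw ?_
    exact han.eqOn_zero_of_preconnected_of_eventuallyEq_zero
      (convex_ball (0 : ℂ) 1).isPreconnected hz h0 hw
  have hdisc : ∀ᶠ y in 𝓝[≠] z, y ∈ disc :=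
    nhdsWithin_le_nhds (isOpen_ball.mem_nhds hz)
  have hFz := ((hF z hz).continuousAt (isOpen_ball.mem_nhds hz)).mono_left
    (nhdsWithin_le_nhds (s := {z}ᶜ))
  have hGz := ((hG z hz).continuousAt (isOpen_ball.mem_nhds hz)).mono_left
    (nhdsWithin_le_nhds (s := {z}ᶜ))
  refine tendsto_nhds_unique_of_eventuallyEq hFz hGz ?_
  filter_upwards [hne, hdisc] with y hy hyd using h y hyd hy

variable [CompleteSpace E]

lemma exists_memHInfty_of_range_eq_span {f : ℂ → E} (hf : MemHInfty f)
    (hin : IsInner (column f)) (hco : IsCoOuter (column f)) {τ : ℂ → ℂ}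
    (hτ : MemHInfty τ) {R : ℂ → E →L[ℂ] E} (hR : MemHInfty R)
    (hRR : ∀ z ∈ disc, R z ∘L R z = τ z • R z)
    (hran : ∀ z ∈ disc, τ z ≠ 0 → (R z).range = Submodule.span ℂ {f z}) :
    ∃ g : ℂ → E →L[ℂ] ℂ, MemHInfty g ∧ ∀ z ∈ disc, g z (f z) = τ z := by
  by_cases hτ0 : ∀ z ∈ disc, τ z = 0
  · exact ⟨0, ⟨differentiableOn_const 0, 0, by simp⟩, fun z hz => by simp [hτ0 z hz]⟩
  push Not at hτ0
  obtain ⟨w, hw, hτw⟩ := hτ0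
  obtain ⟨hRd, C, hC⟩ := hR
  have hfd := hf.1
  have hfc := hfd.continuousOn
  have hf0 : ∀ z ∈ disc, f z ≠ 0 := fun z hz => hco.ne_zero hf hz
  have hRx : ∀ x, ContinuousOn (fun z => R z x) disc := fun x =>
    hRd.continuousOn.clm_apply continuousOn_const
  -- Proportionality of `R z x` and `f z`, written as an identity of continuous functions so that it
  -- extends to the zeros of `τ`.
  have hpar : ∀ e x : E, ∀ z ∈ disc,
      inner ℂ e (f z) • R z x = (inner ℂ e (R z x) : ℂ) • f z := by
    intro e x
    refine eqOn_disc_of_eq_of_ne_zero hτ.1 hw hτw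
      ((continuousOn_const.inner hfc).smul (hRx x))
      ((continuousOn_const.inner (hRx x)).smul hfc) fun z hz hτz => ?_
    have hmem : R z x ∈ (R z).range := ⟨x, rfl⟩
    rw [hran z hz hτz, Submodule.mem_span_singleton] at hmem
    obtain ⟨c, hc⟩ := hmem
    rw [← hc, inner_smul_right, smul_smul, mul_comm]
  have hRf : ∀ z ∈ disc, R z (f z) = τ z • f z := by
    refine eqOn_disc_of_eq_of_ne_zero hτ.1 hw hτw (hRd.continuousOn.clm_apply hfc)
      (hτ.1.continuousOn.smul hfc) fun z hz hτz => ?_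
    have hmem : f z ∈ (R z).range := by
      rw [hran z hz hτz]
      exact Submodule.mem_span_singleton_self _
    obtain ⟨y, hy⟩ := hmem
    have := congrArg (fun T : E →L[ℂ] E => T y) (hRR z hz)
    simpa [← hy] using this
  have hff : ∀ z ∈ disc, inner ℂ (f z) (f z) ≠ 0 := fun z hz => inner_self_ne_zero.2 (hf0 z hz)
  set g : ℂ → E →L[ℂ] ℂ := fun z => (inner ℂ (f z) (f z))⁻¹ • (innerSL ℂ (f z) ∘L R z) with hg
  have hgR : ∀ z ∈ disc, ∀ x, g z x • f z = R z x := by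
    intro z hz x
    have h1 := hpar (f z) x z hz
    simp only [hg, smul_apply, ContinuousLinearMap.comp_apply,
      innerSL_apply_apply, smul_eq_mul]
    rw [mul_smul, ← h1, smul_smul, inv_mul_cancel₀ (hff z hz), one_smul]
  have hgd : DifferentiableOn ℂ g disc := by
    intro z hz
    -- The formula for `g` is not visibly holomorphic. As `R y x` is a multiple of `f y`, pairing
    -- with the frozen vector `f z` gives the same quotient near `z`, now holomorphic in `y`.
    have hd : DifferentiableAt ℂ (fun y => (inner ℂ (f z) (f y))⁻¹ • (innerSL ℂ (f z) ∘L R y)) z := by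
      have hfz := hfd.differentiableAt (isOpen_ball.mem_nhds hz)
      have hRz := hRd.differentiableAt (isOpen_ball.mem_nhds hz)
      have h1 : DifferentiableAt ℂ (fun y => inner ℂ (f z) (f y)) z :=
        (innerSL ℂ (f z)).differentiableAt.comp z hfz
      exact (h1.inv (hff z hz)).smul ((differentiableAt_const _).clm_comp hRz)
    refine (hd.congr_of_eventuallyEq ?_).differentiableWithinAt
    have hne : ∀ᶠ y in 𝓝 z, inner ℂ (f z) (f y) ≠ 0 :=
      (continuousAt_const.inner (hfc.continuousAt (isOpen_ball.mem_nhds hz))).eventually_ne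
        (hff z hz)
    filter_upwards [hne, isOpen_ball.mem_nhds hz] with y hy hyd
    ext x
    have h1 := congrArg (fun t => inner ℂ (f z) t) (hgR y hyd x)
    simp only [inner_smul_right] at h1
    simp only [smul_apply, ContinuousLinearMap.comp_apply,
      innerSL_apply_apply, smul_eq_mul]
    rw [← h1]
    field_simp
  refine ⟨g, ⟨hgd, C, fun z hz => ?_⟩, fun z hz => ?_⟩
  · refine ContinuousLinearMap.opNorm_le_bound _ ((norm_nonneg _).trans (hC z hz)) fun x => ?_
    refine norm_le_of_norm_mul_le hf hin hco (u := fun y => g y x)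
      (hgd.clm_apply (differentiableOn_const x)) (fun y hy => ?_) hz
    rw [← norm_smul, hgR y hy x]
    exact (R y).le_of_opNorm_le (hC y hy) x
  · have h1 := hgR z hz (f z)
    rw [hRf z hz] at h1
    exact smul_left_injective ℂ (hf0 z hz) h1

end Hardy

theorem lemma1p1 {E : Type*} [NormedAddCommGroup E] [InnerProductSpace ℂ E] [CompleteSpace E]
    [TopologicalSpace.SeparableSpace E]
    (f : ℂ → E) (hf : Hardy.MemHInfty f)
    (hf_inner : Hardy.IsInner (Hardy.column f)) (hf_coouter : Hardy.IsCoOuter (Hardy.column f))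
    (τ : ℂ → ℂ) (hτ : Hardy.MemHInfty τ) :
    (∃ g : ℂ → E →L[ℂ] ℂ, Hardy.MemHInfty g ∧ ∀ z ∈ Hardy.disc, g z (f z) = τ z) ↔
      ∃ R : ℂ → E →L[ℂ] E, Hardy.MemHInfty R ∧
        (∀ z ∈ Hardy.disc, R z ∘L R z = τ z • R z) ∧
        ∀ z ∈ Hardy.disc, τ z ≠ 0 → (R z).range = Submodule.span ℂ {f z} := by
  refine ⟨fun ⟨g, hg, hgf⟩ => Hardy.exists_memHInfty_smulRight hf hg hgf, ?_⟩
  rintro ⟨R, hR, hRR, hran⟩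
  exact Hardy.exists_memHInfty_of_range_eq_span hf hf_inner hf_coouter hτ hR hRR hran
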